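/- Let $n,m\ge 1$, let $0<\lambda_1\le\dots\le\lambda_n$ and $0<\mu_1<\dots<\mu_m$, and put $\Lambda^+=\mathrm{diag}(\lambda_1,\dots,\lambda_n)$, $\Lambda^-=\mathrm{diag}(\mu_1,\dots,\mu_m)$. Let $\Sigma^{++}\in\mathbb R^{n\times n}$ and $\Sigma^{+-},Q_0\in\mathbb R^{n\times m}$ be constant matrices, let $C^+$ (with values in $\mathbb R^{n\times n}$) and $C^-$ (with values in $\mathbb R^{n\times m}$) be $L^\infty$ functions on $\mathcal T=\{0\le\xi\le x\le 1\}$, and let $\Omega\in L^\infty((0,1);\mathbb R^{m\times m})$ be upper triangular. Consider, for $t\ge 0$ and $x\in[0,1]$, the system $$\alpha_t(t,x)+\Lambda^+\alpha_x(t,x)=\Sigma^{++}\alpha(t,x)+\Sigma^{+-}\beta(t,x)+\int_0^x C^+(x,\xi)\alpha(t,\xi)\,d\xi+\int_0^x C^-(x,\xi)\beta(t,\xi)\,d\xi,$$ $$\beta_t(t,x)-\Lambda^-\beta_x(t,x)=\Omega(x)\beta(t,x),\qquad \alpha(t,0)=Q_0\beta(t,0),\qquad \beta(t,1)=0,$$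 with initial condition $(\alpha^0,\beta^0)\in L^2([0,1];\mathbb R^{n}\times\mathbb R^m)$. Then every solution $(\alpha,\beta)\in C^0([0,\infty);L^2([0,1];\mathbb R^{n}\times\mathbb R^m))$ reaches the zero equilibrium in finite time $t_F=\frac1{\mu_1}+\frac1{\lambda_1}$. More precisely, $\beta(t,\cdot)=0$ for all $t\ge \frac1{\mu_1}$, and $\alpha(t,\cdot)=0$ and $\beta(t,\cdot)=0$ for all $t\ge t_F$ (equality in $L^2$). Here "solution" is meant in the weak sense: for every $T>0$ and all $C^1$ functions $\varphi:[0,T]\times[0,1]\to\mathbb R^n$, $\psi:[0,T]\times[0,1]\to\mathbb R^m$ with $\varphi(t,1)=0$ and $\Lambda^-\psi(t,0)=Q_0^{\top}\Lambda^+\varphi(t,0)$ for $t\in[0,T]$, $$\int_0^1\big(\varphi(T)^{\top}\alpha(T)+\psi(T)^{\top}\beta(T)\big)dx-\int_0^1\big(\varphi(0)^{\top}\alpha^0+\psi(0)^{\top}\beta^0\big)dx=\int_0^T\!\!\int_0^1\Big((\varphi_t+\Lambda^+\varphi_x)^{\top}\alpha+\varphi^{\top}F+(\psi_t-\Lambda^-\psi_x)^{\top}\beta+\psi^{\top}\Omega\beta\Big)dx\,dt,$$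 where $F$ is the right-hand side of the equation for $\alpha$. -/

import Mathlib

open MeasureTheory Set Filter Topology
open scoped Matrix ENNReal

/-- Lebesgue measure on the space interval `[0,1]`. -/
noncomputable def unitMeasure : Measure ℝ := volume.restrict (Icc 0 1)

/-- The triangle `𝒯 = {(x, ξ) : 0 ≤ ξ ≤ x ≤ 1}`. -/
def triangle : Set (ℝ × ℝ) := {p | 0 ≤ p.2 ∧ p.2 ≤ p.1 ∧ p.1 ≤ 1}

/-- The coefficients of the controller target system
`α_t + Λ⁺ α_x = Σ⁺⁺ α + Σ⁺⁻ β + ∫₀ˣ C⁺(x,ξ) α(t,ξ) dξ + ∫₀ˣ C⁻(x,ξ) β(t,ξ) dξ`,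
`β_t - Λ⁻ β_x = Ω(x) β`, `α(t,0) = Q₀ β(t,0)`, `β(t,1) = 0`,
with `Λ⁺ = diag(lam)`, `Λ⁻ = diag(mu)`. -/
structure TargetSystem (n m : ℕ) where
  /-- transport speeds of `α` -/
  lam : Fin n → ℝ
  /-- transport speeds of `β` (in the direction of decreasing `x`) -/
  mu : Fin m → ℝ
  /-- in-domain coupling `Σ⁺⁺` -/
  Spp : Matrix (Fin n) (Fin n) ℝ
  /-- in-domain coupling `Σ⁺⁻` -/
  Spm : Matrix (Fin n) (Fin m) ℝ
  /-- boundary coupling at `x = 0` -/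
  Q₀ : Matrix (Fin n) (Fin m) ℝ
  /-- integral kernel `C⁺(x, ξ)` -/
  Cp : ℝ → ℝ → Matrix (Fin n) (Fin n) ℝ
  /-- integral kernel `C⁻(x, ξ)` -/
  Cm : ℝ → ℝ → Matrix (Fin n) (Fin m) ℝ
  /-- in-domain coupling `Ω(x)` of the `β` equation -/
  Om : ℝ → Matrix (Fin m) (Fin m) ℝ

namespace TargetSystem

variable {n m : ℕ}

/-- The standing assumptions on the coefficients: `0 < λ₁ ≤ ⋯ ≤ λₙ`, `0 < μ₁ < ⋯ < μₘ`,
`C⁺, C⁻ ∈ L^∞(𝒯)`, `Ω ∈ L^∞(0,1)`, and `Ω` is upper triangular. -/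
structure Admissible (S : TargetSystem n m) : Prop where
  lam_pos : ∀ i, 0 < S.lam i
  lam_mono : Monotone S.lam
  mu_pos : ∀ i, 0 < S.mu i
  mu_strictMono : StrictMono S.mu
  Cp_bdd : ∀ i j, MemLp (fun p : ℝ × ℝ => S.Cp p.1 p.2 i j) ∞ (volume.restrict triangle)
  Cm_bdd : ∀ i j, MemLp (fun p : ℝ × ℝ => S.Cm p.1 p.2 i j) ∞ (volume.restrict triangle)
  Om_bdd : ∀ i j, MemLp (fun x => S.Om x i j) ∞ unitMeasure
  Om_upper : ∀ᵐ x ∂unitMeasure, ∀ i j, j < i → S.Om x i j = 0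

/-- The right-hand side of the `α` equation, for profiles `a`, `b` of `α`, `β` at a fixed time. -/
noncomputable def sourceAlpha (S : TargetSystem n m) (a : ℝ → Fin n → ℝ) (b : ℝ → Fin m → ℝ)
    (x : ℝ) : Fin n → ℝ :=
  S.Spp *ᵥ a x + S.Spm *ᵥ b x
    + (∫ ξ in (0 : ℝ)..x, S.Cp x ξ *ᵥ a ξ) + ∫ ξ in (0 : ℝ)..x, S.Cm x ξ *ᵥ b ξ

end TargetSystem

/-- `w` represents a curve in `C⁰([0,∞); L²((0,1); ℝᵏ))`. (The norm on `Fin k → ℝ` is the maximum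
norm, which defines the same `L²` space with an equivalent norm.) -/
structure IsL2Curve {k : ℕ} (w : ℝ → ℝ → Fin k → ℝ) : Prop where
  aestronglyMeasurable :
    AEStronglyMeasurable (fun p : ℝ × ℝ => w p.1 p.2) (volume.restrict (Ici 0 ×ˢ Icc 0 1))
  memLp : ∀ t, 0 ≤ t → MemLp (w t) 2 unitMeasure
  continuous : ∀ t₀, 0 ≤ t₀ →
    Tendsto (fun t => eLpNorm (w t - w t₀) 2 unitMeasure) (𝓝[Ici 0] t₀) (𝓝 0)

namespace TargetSystem

variable {n m : ℕ}

/-- A pair of `C¹` test functions on `[0,T] × [0,1]` satisfying the adjoint boundary conditions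
`φ(t,1) = 0` and `Λ⁻ ψ(t,0) = Q₀ᵀ Λ⁺ φ(t,0)`. -/
structure IsTestPair (S : TargetSystem n m) (T : ℝ)
    (φ : ℝ → ℝ → Fin n → ℝ) (ψ : ℝ → ℝ → Fin m → ℝ) : Prop where
  contDiff_fst : ContDiff ℝ 1 (fun p : ℝ × ℝ => φ p.1 p.2)
  contDiff_snd : ContDiff ℝ 1 (fun p : ℝ × ℝ => ψ p.1 p.2)
  right : ∀ t ∈ Icc 0 T, φ t 1 = 0
  left : ∀ t ∈ Icc 0 T,
    Matrix.diagonal S.mu *ᵥ ψ t 0 = S.Q₀ᵀ *ᵥ (Matrix.diagonal S.lam *ᵥ φ t 0)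

/-- `(α, β)` is the (weak) `L²` solution on `[0,∞)` of the target system, boundary conditions
included, with initial condition `(α⁰, β⁰)`: it is continuous in time with values in `L²`, and the
equations hold when tested on `[0,T] × [0,1]`, for all `T > 0`, against all `C¹` pairs satisfying
the adjoint boundary conditions. -/
structure IsL2Solution (S : TargetSystem n m) (α₀ : ℝ → Fin n → ℝ) (β₀ : ℝ → Fin m → ℝ)
    (α : ℝ → ℝ → Fin n → ℝ) (β : ℝ → ℝ → Fin m → ℝ) : Prop where
  curve_fst : IsL2Curve α
  curve_snd : IsL2Curve β
  weak : ∀ T, 0 < T → ∀ φ ψ, S.IsTestPair T φ ψ →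
    (∫ x in (0 : ℝ)..1, (φ T x ⬝ᵥ α T x + ψ T x ⬝ᵥ β T x))
      - (∫ x in (0 : ℝ)..1, (φ 0 x ⬝ᵥ α₀ x + ψ 0 x ⬝ᵥ β₀ x))
    = ∫ t in (0 : ℝ)..T, ∫ x in (0 : ℝ)..1,
        ((deriv (fun s => φ s x) t + Matrix.diagonal S.lam *ᵥ deriv (fun y => φ t y) x) ⬝ᵥ α t x
          + φ t x ⬝ᵥ S.sourceAlpha (α t) (β t) x
          + (deriv (fun s => ψ s x) t - Matrix.diagonal S.mu *ᵥ deriv (fun y => ψ t y) x) ⬝ᵥ β t x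
          + ψ t x ⬝ᵥ (S.Om x *ᵥ β t x))

end TargetSystem

/-! Each component is carried along straight characteristics. Since `β` enters through `x = 1` with
value zero and its slowest speed is `S.mu 0`, the region `max 0 (1 - S.mu 0 * t) < x < 1` is reached
only from the zero boundary data, and backward characteristics stay in it until they exit at `x =
1`. Once `β` is gone, the inflow of `α` at `x = 0` is zero, and the same holds for `α` on `0 < x <
min 1 (S.lam 0 * (t - t₀))`. Each region fills `(0,1)` at the claimed time.

The sources do not spoil this: on its region each is bounded in `L¹` by the unknown on the same
region. For the Volterra term this holds because the region of `α` is an interval starting at `0`.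
Gronwall's inequality then gives zero (`ae_eq_zero_of_transport_dual`).

For weak solutions, integration along characteristics is done by duality: a test profile transported
with the flow solves the adjoint transport equation, and its support removes the initial and
boundary terms (`integral_mul_beta`, `integral_mul_alpha`). `lintegral_le_of_transport_dual` turns
the resulting identity into an `L¹` bound. -/

/-! ### Gronwall's inequality and local boundedness in time -/

/-- Integral Gronwall inequality for `[0,∞]`-valued functions (no measurability needed). -/
lemma setLIntegral_eq_zero_of_le_mul_setLIntegral {N : ℝ → ℝ≥0∞} {C : NNReal} {T : ℝ}
    (hfin : ∫⁻ t in Ioc 0 T, N t ≠ ∞)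
    (hN : ∀ t ∈ Ioc 0 T, N t ≤ C * ∫⁻ s in Ioc 0 t, N s) :
    ∫⁻ t in Ioc 0 T, N t = 0 := by
  obtain ⟨δ, hδ, hCδ⟩ : ∃ δ : ℝ, 0 < δ ∧ (C : ℝ≥0∞) * ENNReal.ofReal δ ≤ 2⁻¹ := by
    refine ⟨(2 * ((C : ℝ) + 1))⁻¹, by positivity, ?_⟩
    rw [← ENNReal.ofReal_coe_nnreal, ← ENNReal.ofReal_mul (by positivity)]
    rw [show (2 : ℝ≥0∞)⁻¹ = ENNReal.ofReal (2⁻¹ : ℝ) by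
      rw [ENNReal.ofReal_inv_of_pos (by norm_num)]; simp]
    refine ENNReal.ofReal_le_ofReal ?_
    have : (0 : ℝ) ≤ C := C.2
    rw [mul_inv_le_iff₀ (by positivity)]
    linarith
  have key : ∀ k : ℕ, ∫⁻ t in Ioc 0 (min (k * δ) T), N t = 0 := by
    intro k
    induction k with
    | zero =>
      have : Ioc (0 : ℝ) (min (((0 : ℕ) : ℝ) * δ) T) = ∅ := by
        apply Ioc_eq_empty; simp
      rw [this, setLIntegral_empty]
    | succ k ih =>
      set a := min ((k : ℝ) * δ) T with ha
      set b := min (((k + 1 : ℕ) : ℝ) * δ) T with hb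
      have hab : b - a ≤ δ := by
        have : b ≤ a + δ := by
          rw [ha, hb, ← min_add_add_right]
          push_cast
          exact min_le_min (by linarith) (by linarith)
        linarith
      have hbT : b ≤ T := min_le_right _ _
      set I := ∫⁻ t in Ioc 0 b, N t with hI
      have hIfin : I ≠ ∞ := ne_top_of_le_ne_top hfin
        (lintegral_mono_set (Ioc_subset_Ioc_right hbT))
      by_cases ha0 : 0 ≤ a
      swap
      · have : Ioc (0 : ℝ) b = ∅ := by
          apply Ioc_eq_empty
          have : T < 0 := by
            by_contra hT
            exact ha0 (le_min (by positivity) (not_lt.1 hT))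
          linarith
        simp [hI, this]
      -- Only the last step, of length at most `δ`, contributes, so the choice of `δ` gives a factor
      -- `1/2`; as `I` is finite, it must vanish.
      have h1 : I ≤ 2⁻¹ * I := by
        calc I ≤ ∫⁻ t in Ioc 0 a ∪ Ioc a b, N t := lintegral_mono_set Ioc_subset_Ioc_union_Ioc
          _ ≤ (∫⁻ t in Ioc 0 a, N t) + ∫⁻ t in Ioc a b, N t := lintegral_union_le _ _ _
          _ = ∫⁻ t in Ioc a b, N t := by rw [ih, zero_add]
          _ ≤ ∫⁻ t in Ioc a b, C * I := by
            refine setLIntegral_mono measurable_const fun t ht => ?_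
            refine (hN t ⟨ha0.trans_lt ht.1, ht.2.trans hbT⟩).trans ?_
            gcongr
            exact lintegral_mono_set (Ioc_subset_Ioc_right ht.2)
          _ = (C * ENNReal.ofReal (b - a)) * I := by
            rw [setLIntegral_const, Real.volume_Ioc]; ring
          _ ≤ 2⁻¹ * I := by
            gcongr
            refine le_trans ?_ hCδ
            gcongr
      by_contra h0
      have := ENNReal.half_lt_self h0 hIfin
      rw [div_eq_mul_inv, mul_comm] at this
      exact absurd h1 this.not_ge
  obtain ⟨k, hk⟩ := exists_nat_ge (T / δ)
  have := key k
  rwa [min_eq_right ((div_le_iff₀ hδ).1 hk)] at this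

/-- Continuity gives a bound near each time, and compactness makes it uniform. This supplies the
finiteness without which Gronwall's inequality fails. -/
lemma IsL2Curve.exists_lintegral_enorm_le {k : ℕ} {w : ℝ → ℝ → Fin k → ℝ} (hw : IsL2Curve w)
    (T : ℝ) : ∃ M : ℝ≥0∞, M ≠ ∞ ∧ ∀ t ∈ Icc 0 T, ∫⁻ x, ‖w t x‖ₑ ∂unitMeasure ≤ M := by
  have : IsProbabilityMeasure unitMeasure := ⟨by simp [unitMeasure]⟩
  refine isCompact_Icc.induction_on (s := Icc 0 T)
    (p := fun s => ∃ M : ℝ≥0∞, M ≠ ∞ ∧ ∀ t ∈ s, ∫⁻ x, ‖w t x‖ₑ ∂unitMeasure ≤ M)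
    ⟨0, by simp⟩ ?_ ?_ ?_
  · rintro s t hst ⟨M, hM, h⟩
    exact ⟨M, hM, fun x hx => h x (hst hx)⟩
  · rintro s t ⟨M, hM, h⟩ ⟨M', hM', h'⟩
    refine ⟨max M M', by simp [hM, hM'], ?_⟩
    rintro x (hx | hx)
    · exact (h x hx).trans (le_max_left _ _)
    · exact (h' x hx).trans (le_max_right _ _)
  · intro t₀ ht₀
    have hm : ∀ᶠ t in 𝓝[Icc 0 T] t₀, eLpNorm (w t - w t₀) 2 unitMeasure < 1 :=
      ((hw.continuous t₀ ht₀.1).mono_left (nhdsWithin_mono _ Icc_subset_Ici_self)).eventually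
        (gt_mem_nhds one_pos)
    refine ⟨_, inter_mem hm self_mem_nhdsWithin, 1 + eLpNorm (w t₀) 2 unitMeasure, ?_, ?_⟩
    · simpa using (hw.memLp t₀ ht₀.1).2.ne
    · rintro t ⟨ht, htI⟩
      have h1 := hw.memLp t htI.1
      have h0 := hw.memLp t₀ ht₀.1
      rw [← eLpNorm_one_eq_lintegral_enorm]
      calc eLpNorm (w t) 1 unitMeasure ≤ eLpNorm (w t) 2 unitMeasure :=
            eLpNorm_le_eLpNorm_of_exponent_le one_le_two h1.1
        _ = eLpNorm ((w t - w t₀) + w t₀) 2 unitMeasure := by rw [sub_add_cancel]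
        _ ≤ eLpNorm (w t - w t₀) 2 unitMeasure + eLpNorm (w t₀) 2 unitMeasure :=
            eLpNorm_add_le (h1.1.sub h0.1) h0.1 one_le_two
        _ ≤ _ := by gcongr; exact ht.le

/-! ### Transport equations by duality -/

/-- An `L¹` bound along characteristics: if `f` is, in the sense of distributions on `U T`, the
value at time `T` of the solution of a transport equation of speed `c` with source `h` and with
vanishing data, and if the characteristics ending in `U T` stay in `U`, then `f` is bounded by the
integral of the source over `U`. -/
lemma lintegral_le_of_transport_dual {T c : ℝ} {U : ℝ → Set ℝ}
    (hU : MeasurableSet {p : ℝ × ℝ | p.2 ∈ U p.1}) (hUo : IsOpen (U T))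
    (hU01 : ∀ t, U t ⊆ Ioo 0 1) {f : ℝ → ℝ} (hf : IntegrableOn f (U T)) {h : ℝ → ℝ → ℝ}
    (hT : 0 < T)
    (hm : AEStronglyMeasurable (fun p : ℝ × ℝ => h p.1 p.2)
      (volume.restrict (Ici 0 ×ˢ Icc 0 1)))
    (hfin : ∫⁻ t in Ioc 0 T, ∫⁻ x in U t, ‖h t x‖ₑ ≠ ∞)
    (hchar : ∀ t ∈ Ioc 0 T, ∀ x ∈ Ioo (0 : ℝ) 1, x + c * (T - t) ∈ U T → x ∈ U t)
    (hdual : ∀ η : ℝ → ℝ, ContDiff ℝ 1 η → tsupport η ⊆ U T →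
      ∫ x in (0 : ℝ)..1, η x * f x
        = ∫ t in (0 : ℝ)..T, ∫ x in (0 : ℝ)..1, η (x + c * (T - t)) * h t x) :
    ∫⁻ x in U T, ‖f x‖ₑ ≤ ∫⁻ t in Ioc 0 T, ∫⁻ x in U t, ‖h t x‖ₑ := by
  set D : Set (ℝ × ℝ) := {p | p.1 ∈ Ioc 0 T ∧ p.2 ∈ U p.1} with hD
  have hDm : MeasurableSet D := (measurable_fst measurableSet_Ioc).inter hU
  have hUm : ∀ t, MeasurableSet (U t) := fun t => measurable_prodMk_left hU
  -- Extension by zero to the plane, so that the shear and Fubini apply without boundaries.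
  set H : ℝ × ℝ → ℝ := D.indicator (fun p => h p.1 p.2) with hH
  have hHm : AEStronglyMeasurable H (volume.prod volume) := by
    rw [hH, aestronglyMeasurable_indicator_iff hDm]
    refine hm.mono_set ?_
    rintro ⟨t, x⟩ ⟨h1, h2⟩
    exact ⟨h1.1.le, Ioo_subset_Icc_self (hU01 t h2)⟩
  have hHl : ∫⁻ p, ‖H p‖ₑ ∂(volume.prod volume)
      = ∫⁻ t in Ioc 0 T, ∫⁻ x in U t, ‖h t x‖ₑ := by
    rw [lintegral_prod _ hHm.enorm, ← lintegral_indicator measurableSet_Ioc]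
    refine lintegral_congr fun t => ?_
    by_cases ht : t ∈ Ioc 0 T
    · rw [indicator_of_mem ht, ← lintegral_indicator (hUm t)]
      refine lintegral_congr fun x => ?_
      by_cases hx : x ∈ U t
      · rw [indicator_of_mem hx, hH, indicator_of_mem (show (t, x) ∈ D from ⟨ht, hx⟩)]
      · rw [indicator_of_notMem hx, hH, indicator_of_notMem (fun hc => hx hc.2), enorm_zero]
    · rw [indicator_of_notMem ht]
      have : ∀ x, H (t, x) = 0 := fun x => indicator_of_notMem (fun hc => ht hc.1) _
      simp [this]
  have hHi : Integrable H (volume.prod volume) := ⟨hHm, by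
    rw [HasFiniteIntegral, hHl]; exact hfin.lt_top⟩
  -- This shear straightens the characteristics into lines of constant `y`, where `y` is the
  -- position at time `T`.
  have hshear : MeasurePreserving (fun p : ℝ × ℝ => (p.1, p.2 - c * (T - p.1)))
      (volume.prod volume) (volume.prod volume) := by
    refine (MeasurePreserving.id volume).skew_product
      (g := fun t x => x - c * (T - t)) (by fun_prop) (Eventually.of_forall fun t => ?_)
    exact (measurePreserving_sub_right volume (c * (T - t))).map_eq
  set K : ℝ × ℝ → ℝ := fun p => H (p.1, p.2 - c * (T - p.1)) with hK
  have hKi : Integrable K (volume.prod volume) := (hshear.integrable_comp hHm).2 hHi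
  have hKl : ∫⁻ p, ‖K p‖ₑ ∂(volume.prod volume)
      = ∫⁻ t in Ioc 0 T, ∫⁻ x in U t, ‖h t x‖ₑ := by
    have h1 := lintegral_map' (f := fun p => ‖H p‖ₑ) (by rw [hshear.map_eq]; exact hHm.enorm)
      hshear.measurable.aemeasurable
    rw [hshear.map_eq] at h1
    rw [← hHl, h1]
  -- The Duhamel formula: the source integrated along the characteristic that ends at `y`. Testing
  -- against all `η` identifies it with `f` on `U T`.
  set G : ℝ → ℝ := fun y => ∫ t, K (t, y) with hG
  have hGi : Integrable G := hKi.integral_prod_right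
  have hfG : ∀ᵐ x, x ∈ U T → f x - G x = 0 := by
    refine hUo.ae_eq_zero_of_integral_contDiff_smul_eq_zero (f := fun x => f x - G x)
      (hf.sub hGi.integrableOn).locallyIntegrableOn ?_
    intro η hη hηc hηU
    obtain ⟨B, hB⟩ := hηc.exists_bound_of_continuous hη.continuous
    have hη0 : ∀ x, x ∉ U T → η x = 0 := fun x hx =>
      image_eq_zero_of_notMem_tsupport fun hc => hx (hηU hc)
    have hηG : Integrable (fun x => η x * G x) :=
      hGi.bdd_mul hη.continuous.aestronglyMeasurable (Eventually.of_forall hB)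
    have hηf : Integrable (fun x => η x * f x) := by
      have h1 : IntegrableOn (fun x => η x * f x) (U T) :=
        Integrable.bdd_mul hf hη.continuous.aestronglyMeasurable (Eventually.of_forall hB)
      rwa [integrableOn_iff_integrable_of_support_subset] at h1
      intro x hx
      by_contra hc
      exact hx (by simp [hη0 x hc])
    have h1 : ∫ x in (0 : ℝ)..1, η x * f x = ∫ x, η x * f x := by
      rw [intervalIntegral.integral_of_le zero_le_one, integral_Ioc_eq_integral_Ioo]
      refine setIntegral_eq_integral_of_forall_compl_eq_zero fun x hx => ?_
      rw [hη0 x fun hc => hx (hU01 T hc), zero_mul]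
    have h2 : ∫ t in (0 : ℝ)..T, ∫ x in (0 : ℝ)..1, η (x + c * (T - t)) * h t x
        = ∫ t, ∫ x, η (x + c * (T - t)) * H (t, x) := by
      rw [intervalIntegral.integral_of_le hT.le, ← integral_indicator measurableSet_Ioc]
      refine integral_congr_ae (Eventually.of_forall fun t => ?_)
      by_cases ht : t ∈ Ioc 0 T
      · simp only [indicator_of_mem ht]
        rw [intervalIntegral.integral_of_le zero_le_one, integral_Ioc_eq_integral_Ioo,
          ← integral_indicator measurableSet_Ioo]
        refine integral_congr_ae (Eventually.of_forall fun x => ?_)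
        by_cases hx : x ∈ U t
        · simp only [indicator_of_mem (hU01 t hx)]
          rw [hH, indicator_of_mem (show (t, x) ∈ D from ⟨ht, hx⟩)]
        · have : H (t, x) = 0 := indicator_of_notMem (fun hc => hx hc.2) _
          simp only [this, mul_zero]
          -- Discarding the source outside `U t` is harmless: by `hchar`, such points are not
          -- carried into `U T`, where `η` lives.
          refine indicator_apply_eq_zero.2 fun hx1 => ?_
          rw [hη0 _ fun hc => hx (hchar t ht x hx1 hc), zero_mul]
      · have : ∀ x, H (t, x) = 0 := fun x => indicator_of_notMem (fun hc => ht hc.1) _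
        simp [this, indicator_of_notMem ht]
    have h3 : ∫ t, ∫ x, η (x + c * (T - t)) * H (t, x) = ∫ t, ∫ y, η y * K (t, y) := by
      congr 1
      ext t
      rw [← integral_sub_right_eq_self _ (c * (T - t))]
      simp [hK]
    have h4 : ∫ t, ∫ y, η y * K (t, y) = ∫ y, η y * G y := by
      rw [integral_integral_swap (f := fun t y => η y * K (t, y))]
      · simp only [hG, integral_const_mul]
      · exact hKi.bdd_mul (hη.continuous.comp continuous_snd).aestronglyMeasurable
          (Eventually.of_forall fun p => hB p.2)
    have h5 := hdual η (hη.of_le (by exact_mod_cast le_top)) hηU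
    rw [h1, h2, h3, h4] at h5
    simp only [smul_eq_mul, mul_sub]
    rw [integral_sub hηf hηG, h5, sub_self]
  calc ∫⁻ x in U T, ‖f x‖ₑ = ∫⁻ x in U T, ‖G x‖ₑ := by
        refine setLIntegral_congr_fun_ae (hUm T) ?_
        filter_upwards [hfG] with x hx hxU
        rw [sub_eq_zero.1 (hx hxU)]
    _ ≤ ∫⁻ x, ‖G x‖ₑ := setLIntegral_le_lintegral _ _
    _ ≤ ∫⁻ y, ∫⁻ t, ‖K (t, y)‖ₑ := lintegral_mono fun y => enorm_integral_le_lintegral_enorm _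
    _ = ∫⁻ t, ∫⁻ y, ‖K (t, y)‖ₑ :=
        (lintegral_lintegral_swap (f := fun t y => ‖K (t, y)‖ₑ) hKi.1.enorm).symm
    _ = _ := by rw [← hKl, lintegral_prod _ hKi.1.enorm]

/-- A system of transport equations with speeds `c i` and sources `h` which vanish with the state,
in the `L¹` sense on the domain `U`, has zero solution on `U` if the data vanish and the
characteristics ending in `U` stay in `U`. -/
lemma ae_eq_zero_of_transport_dual {k : ℕ} {w h : ℝ → ℝ → Fin k → ℝ} (hw : IsL2Curve w)
    {c : Fin k → ℝ} {U : ℝ → Set ℝ}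
    (hU : MeasurableSet {p : ℝ × ℝ | p.2 ∈ U p.1}) (hUo : ∀ t, IsOpen (U t))
    (hU01 : ∀ t, U t ⊆ Ioo 0 1)
    (hm : ∀ i, AEStronglyMeasurable (fun p : ℝ × ℝ => h p.1 p.2 i)
      (volume.restrict (Ici 0 ×ˢ Icc 0 1)))
    {C : NNReal}
    (hC : ∀ t, 0 < t → ∀ i, ∫⁻ x in U t, ‖h t x i‖ₑ ≤ C * ∫⁻ x in U t, ‖w t x‖ₑ)
    (hchar : ∀ i t T, 0 < t → t ≤ T → ∀ x ∈ Ioo (0 : ℝ) 1, x + c i * (T - t) ∈ U T → x ∈ U t)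
    (hdual : ∀ T, 0 < T → ∀ i, ∀ η : ℝ → ℝ, ContDiff ℝ 1 η → tsupport η ⊆ U T →
      ∫ x in (0 : ℝ)..1, η x * w T x i
        = ∫ t in (0 : ℝ)..T, ∫ x in (0 : ℝ)..1, η (x + c i * (T - t)) * h t x i)
    {T : ℝ} (hT : 0 < T) : ∀ᵐ x, x ∈ U T → w T x = 0 := by
  have hprob : IsProbabilityMeasure unitMeasure := ⟨by simp [unitMeasure]⟩
  set N : ℝ → ℝ≥0∞ := fun t => ∫⁻ x in U t, ‖w t x‖ₑ with hN
  have hUm : ∀ t, MeasurableSet (U t) := fun t => (hUo t).measurableSet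
  have hle : ∀ t, N t ≤ ∫⁻ x, ‖w t x‖ₑ ∂unitMeasure := fun t =>
    lintegral_mono_set ((hU01 t).trans Ioo_subset_Icc_self)
  have hfin : ∀ S, ∫⁻ t in Ioc 0 S, N t ≠ ∞ := by
    intro S
    obtain ⟨M, hM, h⟩ := hw.exists_lintegral_enorm_le S
    refine ne_top_of_le_ne_top (b := ∫⁻ t in Ioc 0 S, M) ?_ ?_
    · rw [setLIntegral_const, Real.volume_Ioc]
      exact ENNReal.mul_ne_top hM ENNReal.ofReal_ne_top
    · exact setLIntegral_mono measurable_const fun t ht => (hle t).trans (h t ⟨ht.1.le, ht.2⟩)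
  have hsrc : ∀ S i, ∫⁻ t in Ioc 0 S, ∫⁻ x in U t, ‖h t x i‖ₑ ≤ C * ∫⁻ t in Ioc 0 S, N t := by
    intro S i
    rw [← lintegral_const_mul' _ _ ENNReal.coe_ne_top]
    exact setLIntegral_mono' measurableSet_Ioc fun t ht => hC t ht.1 i
  have hcomp : ∀ S, 0 < S → ∀ i, ∫⁻ x in U S, ‖w S x i‖ₑ ≤ C * ∫⁻ t in Ioc 0 S, N t := by
    intro S hS i
    refine (lintegral_le_of_transport_dual hU (hUo S) hU01 ?_ hS (hm i) ?_
      (fun t ht x hx hxU => hchar i t S ht.1 ht.2 x hx hxU)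
      (hdual S hS i)).trans (hsrc S i)
    · have h1 : Integrable (w S) unitMeasure := (hw.memLp S hS.le).integrable one_le_two
      exact (h1.eval i).mono_measure
        (Measure.restrict_mono ((hU01 S).trans Ioo_subset_Icc_self) le_rfl)
    · exact ne_top_of_le_ne_top (ENNReal.mul_ne_top ENNReal.coe_ne_top (hfin S)) (hsrc S i)
  have hsum : ∀ S, 0 < S → N S ≤ (k * C : NNReal) * ∫⁻ t in Ioc 0 S, N t := by
    intro S hS
    have hmeas : ∀ i ∈ Finset.univ, AEMeasurable (fun x => ‖w S x i‖ₑ) (volume.restrict (U S)) := by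
      intro i _
      have h1 : AEStronglyMeasurable (fun x => w S x i) unitMeasure :=
        (((hw.memLp S hS.le).integrable one_le_two).eval i).1
      exact (h1.mono_measure
        (Measure.restrict_mono ((hU01 S).trans Ioo_subset_Icc_self) le_rfl)).enorm
    calc N S ≤ ∫⁻ x in U S, ∑ i, ‖w S x i‖ₑ := by
          refine lintegral_mono fun x => ?_
          have : ‖w S x‖ₑ ≤ ENNReal.ofReal (∑ i, ‖w S x i‖) := by
            rw [← ofReal_norm]
            refine ENNReal.ofReal_le_ofReal
              ((pi_norm_le_iff_of_nonneg (Finset.sum_nonneg fun _ _ => norm_nonneg _)).2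
                fun i => Finset.single_le_sum (f := fun i => ‖w S x i‖)
                  (fun _ _ => norm_nonneg _) (Finset.mem_univ i))
          rw [ENNReal.ofReal_sum_of_nonneg fun _ _ => norm_nonneg _] at this
          simpa only [ofReal_norm] using this
      _ = ∑ i, ∫⁻ x in U S, ‖w S x i‖ₑ := lintegral_finsetSum' _ hmeas
      _ ≤ ∑ _i : Fin k, C * ∫⁻ t in Ioc 0 S, N t := Finset.sum_le_sum fun i _ => hcomp S hS i
      _ = _ := by simp [mul_assoc]
  -- Gronwall only kills the time integral of `N`; reinserting this in `hsum` gives zero at the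
  -- given time `T`, not just at almost every time.
  have hN0 : N T = 0 := by
    have := setLIntegral_eq_zero_of_le_mul_setLIntegral (hfin T) fun t ht => hsum t ht.1
    simpa [this] using hsum T hT
  have hwm : AEMeasurable (fun x => ‖w T x‖ₑ) (volume.restrict (U T)) :=
    ((hw.memLp T hT.le).1.mono_measure
      (Measure.restrict_mono ((hU01 T).trans Ioo_subset_Icc_self) le_rfl)).enorm
  rw [hN, lintegral_eq_zero_iff' hwm] at hN0
  filter_upwards [(ae_restrict_iff' (hUm T)).1 hN0] with x hx hxU
  simpa using hx hxU

/-! ### Bounds and measurability of the coupling terms -/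

lemma enorm_mulVec_apply_le {k l : ℕ} {A : Matrix (Fin k) (Fin l) ℝ} {K : NNReal}
    (hA : ∀ i j, ‖A i j‖ₑ ≤ K) (v : Fin l → ℝ) (i : Fin k) :
    ‖(A *ᵥ v) i‖ₑ ≤ (l * K : NNReal) * ‖v‖ₑ := by
  have hA' : ∀ i j, ‖A i j‖₊ ≤ K := fun i j => by simpa [enorm_eq_nnnorm] using hA i j
  rw [enorm_eq_nnnorm, enorm_eq_nnnorm, ← ENNReal.coe_mul, ENNReal.coe_le_coe]
  calc ‖(A *ᵥ v) i‖₊ ≤ ∑ j, ‖A i j * v j‖₊ :=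
        nnnorm_sum_le Finset.univ fun j => A i j * v j
    _ ≤ ∑ _j : Fin l, K * ‖v‖₊ := by
      refine Finset.sum_le_sum fun j _ => ?_
      rw [nnnorm_mul]
      exact mul_le_mul' (hA' i j) (nnnorm_le_pi_nnnorm v j)
    _ = _ := by simp [mul_assoc]

lemma enorm_mulVec_le {k l : ℕ} {A : Matrix (Fin k) (Fin l) ℝ} {K : NNReal}
    (hA : ∀ i j, ‖A i j‖ₑ ≤ K) (v : Fin l → ℝ) :
    ‖A *ᵥ v‖ₑ ≤ (l * K : NNReal) * ‖v‖ₑ := by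
  have := enorm_mulVec_apply_le hA v
  simp only [enorm_eq_nnnorm, ← ENNReal.coe_mul, ENNReal.coe_le_coe] at this ⊢
  exact pi_nnnorm_le_iff.2 this

lemma exists_ae_forall_enorm_le {X : Type*} [MeasurableSpace X] {ν : Measure X} {k l : ℕ}
    {A : X → Matrix (Fin k) (Fin l) ℝ} (hA : ∀ i j, MemLp (fun x => A x i j) ∞ ν) :
    ∃ K : NNReal, ∀ᵐ x ∂ν, ∀ i j, ‖A x i j‖ₑ ≤ K := by
  refine ⟨∑ i, ∑ j, (eLpNorm (fun x => A x i j) ∞ ν).toNNReal, ?_⟩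
  simp only [ae_all_iff]
  intro i j
  filter_upwards [ae_le_eLpNormEssSup (f := fun x => A x i j) (μ := ν)] with x hx
  rw [← eLpNorm_exponent_top, ← ENNReal.coe_toNNReal (hA i j).2.ne] at hx
  refine hx.trans (ENNReal.coe_le_coe.2 ?_)
  refine le_trans ?_ (Finset.single_le_sum (f := fun i =>
    ∑ j, (eLpNorm (fun x => A x i j) ∞ ν).toNNReal) (fun _ _ => zero_le) (Finset.mem_univ i))
  exact Finset.single_le_sum (f := fun j => (eLpNorm (fun x => A x i j) ∞ ν).toNNReal)
    (fun _ _ => zero_le) (Finset.mem_univ j)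

lemma aestronglyMeasurable_mulVec_apply {X : Type*} [MeasurableSpace X] {ν : Measure X} {k l : ℕ}
    {A : X → Matrix (Fin k) (Fin l) ℝ} {v : X → Fin l → ℝ} {i : Fin k}
    (hA : ∀ j, AEStronglyMeasurable (fun x => A x i j) ν) (hv : AEStronglyMeasurable v ν) :
    AEStronglyMeasurable (fun x => (A x *ᵥ v x) i) ν := by
  simp only [Matrix.mulVec, dotProduct]
  refine Finset.aestronglyMeasurable_fun_sum _ fun j _ => (hA j).mul ?_
  exact (continuous_apply j).comp_aestronglyMeasurable hv

lemma aestronglyMeasurable_mulVec {X : Type*} [MeasurableSpace X] {ν : Measure X} {k l : ℕ}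
    {A : X → Matrix (Fin k) (Fin l) ℝ} {v : X → Fin l → ℝ}
    (hA : ∀ i j, AEStronglyMeasurable (fun x => A x i j) ν) (hv : AEStronglyMeasurable v ν) :
    AEStronglyMeasurable (fun x => A x *ᵥ v x) ν :=
  (aemeasurable_pi_iff.2 fun i =>
    (aestronglyMeasurable_mulVec_apply (hA i) hv).aemeasurable).aestronglyMeasurable

lemma measurableSet_triangle : MeasurableSet triangle := by
  have : IsClosed triangle :=
    (isClosed_le continuous_const continuous_snd).inter
      ((isClosed_le continuous_snd continuous_fst).inter
        (isClosed_le continuous_fst continuous_const))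
  exact this.measurableSet

lemma restrict_Ici_prod_Icc :
    (volume : Measure (ℝ × ℝ)).restrict (Ici 0 ×ˢ Icc 0 1)
      = (volume.restrict (Ici 0)).prod unitMeasure := by
  rw [unitMeasure, Measure.prod_restrict, Measure.volume_eq_prod]

/-- Joint measurability of a Volterra integral operator with kernel on the triangle, applied to the
time slices of a function. -/
lemma aestronglyMeasurable_volterra {k l : ℕ} {A : ℝ → ℝ → Matrix (Fin k) (Fin l) ℝ}
    {w : ℝ → ℝ → Fin l → ℝ}
    (hA : ∀ i j, AEStronglyMeasurable (fun p : ℝ × ℝ => A p.1 p.2 i j) (volume.restrict triangle))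
    (hw : AEStronglyMeasurable (fun p : ℝ × ℝ => w p.1 p.2)
      (volume.restrict (Ici 0 ×ˢ Icc 0 1))) :
    AEStronglyMeasurable (fun p : ℝ × ℝ => ∫ ξ in (0 : ℝ)..p.2, A p.2 ξ *ᵥ w p.1 ξ)
      (volume.restrict (Ici 0 ×ˢ Icc 0 1)) := by
  have hfin : IsFiniteMeasure unitMeasure := ⟨by simp [unitMeasure]⟩
  -- With the kernel extended by zero, the variable upper limit becomes a fixed domain and the
  -- integral is a measurable parameter integral.
  set B : ℝ × ℝ → Matrix (Fin k) (Fin l) ℝ :=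
    fun p i j => triangle.indicator (fun p : ℝ × ℝ => A p.1 p.2 i j) p with hB
  have hBm : ∀ i j, AEStronglyMeasurable (fun p => B p i j) (unitMeasure.prod unitMeasure) := by
    intro i j
    have : AEStronglyMeasurable (fun p => B p i j) volume :=
      (aestronglyMeasurable_indicator_iff measurableSet_triangle).2 (hA i j)
    rw [unitMeasure, Measure.prod_restrict, ← Measure.volume_eq_prod]
    exact this.mono_measure Measure.restrict_le_self
  rw [restrict_Ici_prod_Icc] at hw ⊢
  have hV : AEStronglyMeasurable
      (fun q : (ℝ × ℝ) × ℝ => B (q.1.2, q.2) *ᵥ w q.1.1 q.2)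
      (((volume.restrict (Ici 0)).prod unitMeasure).prod unitMeasure) := by
    refine aestronglyMeasurable_mulVec (fun i j => ?_) ?_
    · exact (hBm i j).comp_quasiMeasurePreserving
        (MeasureTheory.QuasiMeasurePreserving.prodMap
          Measure.quasiMeasurePreserving_snd (Measure.QuasiMeasurePreserving.id unitMeasure))
    · exact hw.comp_quasiMeasurePreserving
        (MeasureTheory.QuasiMeasurePreserving.prodMap
          Measure.quasiMeasurePreserving_fst (Measure.QuasiMeasurePreserving.id unitMeasure))
  refine hV.integral_prod_right'.congr ?_
  rw [← restrict_Ici_prod_Icc]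
  filter_upwards [ae_restrict_mem (measurableSet_Ici.prod measurableSet_Icc)] with p hp
  obtain ⟨hp0, hp1⟩ : 0 ≤ p.2 ∧ p.2 ≤ 1 := hp.2
  rw [intervalIntegral.integral_of_le hp0, unitMeasure, ← integral_Icc_eq_integral_Ioc,
    ← integral_indicator measurableSet_Icc, ← integral_indicator measurableSet_Icc]
  refine integral_congr_ae (Eventually.of_forall fun ξ => ?_)
  by_cases hξ : ξ ∈ Icc 0 p.2
  · have h1 : B (p.2, ξ) = A p.2 ξ := by
      ext i j
      exact indicator_of_mem (show (p.2, ξ) ∈ triangle from ⟨hξ.1, hξ.2, hp1⟩) _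
    simp only [indicator_of_mem hξ, indicator_of_mem (show ξ ∈ Icc (0 : ℝ) 1 from
      ⟨hξ.1, hξ.2.trans hp1⟩), h1]
  · have h1 : B (p.2, ξ) = 0 := by
      ext i j
      exact indicator_of_notMem (fun h : (p.2, ξ) ∈ triangle => hξ ⟨h.1, h.2.1⟩) _
    simp [indicator_of_notMem hξ, h1]

/-! ### Transported test profiles -/

lemma hasDerivAt_pi_single {k : ℕ} (i : Fin k) {g : ℝ → ℝ} {g' t : ℝ} (hg : HasDerivAt g g' t) :
    HasDerivAt (fun s => (Pi.single i (g s) : Fin k → ℝ)) (Pi.single i g') t := by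
  rw [hasDerivAt_pi]
  intro j
  by_cases h : j = i
  · subst h; simpa using hg
  · simpa [Pi.single_eq_of_ne h] using hasDerivAt_const t (0 : ℝ)

lemma contDiff_pi_single_comp {k : ℕ} (i : Fin k) {η : ℝ → ℝ} (hη : ContDiff ℝ 1 η) (c T : ℝ) :
    ContDiff ℝ 1 (fun p : ℝ × ℝ =>
      (Pi.single i (η (p.2 + c * (T - p.1))) : Fin k → ℝ)) := by
  rw [contDiff_pi]
  intro j
  by_cases h : j = i
  · subst h
    simp only [Pi.single_eq_same]
    exact hη.comp (by fun_prop)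
  · simp only [Pi.single_eq_of_ne h]
    exact contDiff_const

/-- A profile transported at speed `c i` in the `i`-th component is annihilated by the transport
operator. -/
lemma deriv_add_diagonal_mulVec_deriv_eq_zero {k : ℕ} (c : Fin k → ℝ) (i : Fin k) {η : ℝ → ℝ}
    (hη : ContDiff ℝ 1 η) (T t x : ℝ) :
    deriv (fun s => (Pi.single i (η (x + c i * (T - s))) : Fin k → ℝ)) t
      + Matrix.diagonal c *ᵥ
        deriv (fun y => (Pi.single i (η (y + c i * (T - t))) : Fin k → ℝ)) x = 0 := by
  have hd := (hη.differentiable one_ne_zero (x + c i * (T - t))).hasDerivAt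
  have h1 : HasDerivAt (fun s => η (x + c i * (T - s)))
      (deriv η (x + c i * (T - t)) * (c i * (-1))) t :=
    hd.comp t ((((hasDerivAt_id t).const_sub T).const_mul (c i)).const_add x)
  have h2 : HasDerivAt (fun y => η (y + c i * (T - t))) (deriv η (x + c i * (T - t)) * 1) x :=
    hd.comp x ((hasDerivAt_id x).add_const _)
  rw [(hasDerivAt_pi_single i h1).deriv, (hasDerivAt_pi_single i h2).deriv,
    Matrix.diagonal_mulVec_single, ← Pi.single_add]
  rw [show deriv η (x + c i * (T - t)) * (c i * -1) + c i * (deriv η (x + c i * (T - t)) * 1) = 0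
    by ring, Pi.single_zero]

lemma ae_unitMeasure_of_ae_Ioo {p : ℝ → Prop} (h : ∀ᵐ x : ℝ, x ∈ Ioo (0 : ℝ) 1 → p x) :
    ∀ᵐ x ∂unitMeasure, p x := by
  rw [unitMeasure, ← Measure.restrict_congr_set Ioo_ae_eq_Icc]
  exact (ae_restrict_iff' measurableSet_Ioo).2 h

namespace TargetSystem

variable {n m : ℕ}

/-! ### Vanishing of `β` -/

/-- The test pair is `φ = 0` and `η` transported backward in time along the `i`-th characteristics.
Its support lies to the right of `x = 0` at all times, so the adjoint condition reads `0 = 0`, and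
beyond `x = 1` at time `0`, so the initial data drop out. -/
lemma IsL2Solution.integral_mul_beta [NeZero m] {S : TargetSystem n m} (hS : S.Admissible)
    {α₀ : ℝ → Fin n → ℝ} {β₀ : ℝ → Fin m → ℝ} {α : ℝ → ℝ → Fin n → ℝ} {β : ℝ → ℝ → Fin m → ℝ}
    (hsol : S.IsL2Solution α₀ β₀ α β) {T : ℝ} (hT : 0 < T) (i : Fin m) {η : ℝ → ℝ}
    (hη : ContDiff ℝ 1 η) (hηU : tsupport η ⊆ Ioo (max 0 (1 - S.mu 0 * T)) 1) :
    ∫ x in (0 : ℝ)..1, η x * β T x i = ∫ t in (0 : ℝ)..T, ∫ x in (0 : ℝ)..1,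
      η (x + -S.mu i * (T - t)) * (S.Om x *ᵥ β t x) i := by
  have hη0 : ∀ x, x ≤ max 0 (1 - S.mu 0 * T) → η x = 0 := fun x hx =>
    image_eq_zero_of_notMem_tsupport fun hc => (hηU hc).1.not_ge hx
  have hμ : S.mu 0 ≤ S.mu i := hS.mu_strictMono.monotone (Fin.zero_le i)
  have htest : S.IsTestPair T (fun _ _ => 0)
      (fun t x => Pi.single i (η (x + -S.mu i * (T - t)))) := by
    refine ⟨contDiff_const, contDiff_pi_single_comp i hη _ _, fun _ _ => rfl, fun t ht => ?_⟩
    have : 0 ≤ S.mu i * (T - t) := mul_nonneg (hS.mu_pos i).le (by linarith [ht.2])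
    rw [hη0 _ (le_max_of_le_left (by linarith))]
    simp
  have h := hsol.weak T hT _ _ htest
  have h0 : ∫ x in (0 : ℝ)..1, ((0 : Fin n → ℝ) ⬝ᵥ α₀ x
      + (Pi.single i (η (x + -S.mu i * (T - 0))) : Fin m → ℝ) ⬝ᵥ β₀ x) = 0 := by
    refine intervalIntegral.integral_zero_ae (Eventually.of_forall fun x hx => ?_)
    rw [uIoc_of_le zero_le_one] at hx
    have : S.mu 0 * T ≤ S.mu i * T := by gcongr
    rw [hη0 _ (le_max_of_le_right (by linarith [hx.2]))]
    simp
  have hdiag : ∀ v : Fin m → ℝ, Matrix.diagonal S.mu *ᵥ v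
      = -(Matrix.diagonal (fun j => -S.mu j) *ᵥ v) := by
    intro v
    ext j
    simp [Matrix.mulVec_diagonal]
  rw [h0, sub_zero] at h
  have hsrc : ∀ t x, deriv (fun s => (Pi.single i (η (x + -S.mu i * (T - s))) : Fin m → ℝ)) t
      - Matrix.diagonal S.mu *ᵥ
        deriv (fun y => (Pi.single i (η (y + -S.mu i * (T - t))) : Fin m → ℝ)) x = 0 := by
    intro t x
    rw [hdiag, sub_neg_eq_add]
    exact deriv_add_diagonal_mulVec_deriv_eq_zero (fun j => -S.mu j) i hη T t x
  simp only [hsrc] at h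
  simpa using h

theorem IsL2Solution.beta_ae_eq_zero [NeZero m] {S : TargetSystem n m} (hS : S.Admissible)
    {α₀ : ℝ → Fin n → ℝ} {β₀ : ℝ → Fin m → ℝ} {α : ℝ → ℝ → Fin n → ℝ} {β : ℝ → ℝ → Fin m → ℝ}
    (hsol : S.IsL2Solution α₀ β₀ α β) {T : ℝ} (hT : 1 / S.mu 0 ≤ T) :
    β T =ᵐ[unitMeasure] 0 := by
  have hμ0 : 0 < S.mu 0 := hS.mu_pos 0
  obtain ⟨K, hK⟩ := exists_ae_forall_enorm_le hS.Om_bdd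
  have hlt : ∀ t, Ioo (max 0 (1 - S.mu 0 * t)) 1 ⊆ Ioo 0 1 := fun t =>
    Ioo_subset_Ioo_left (le_max_left _ _)
  have key := ae_eq_zero_of_transport_dual hsol.curve_snd (c := fun i => -S.mu i)
    (h := fun t x => S.Om x *ᵥ β t x) (U := fun t => Ioo (max 0 (1 - S.mu 0 * t)) 1)
    (C := m * K) ?_ (fun t => isOpen_Ioo) hlt ?_ ?_ ?_
    (fun T hT i η hη hηU => hsol.integral_mul_beta hS hT i hη hηU)
    (lt_of_lt_of_le (by positivity) hT)
  · refine ae_unitMeasure_of_ae_Ioo ?_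
    filter_upwards [key] with x hx hx1
    refine hx ⟨max_lt hx1.1 ?_, hx1.2⟩
    rw [div_le_iff₀' hμ0] at hT
    linarith [hx1.1]
  · exact (measurableSet_lt (f := fun p : ℝ × ℝ => max 0 (1 - S.mu 0 * p.1)) (by fun_prop)
      measurable_snd).inter (measurableSet_lt measurable_snd measurable_const)
  · intro i
    refine aestronglyMeasurable_mulVec_apply (A := fun p : ℝ × ℝ => S.Om p.2) (fun j => ?_)
      hsol.curve_snd.aestronglyMeasurable
    rw [restrict_Ici_prod_Icc]
    exact (hS.Om_bdd i j).1.comp_quasiMeasurePreserving Measure.quasiMeasurePreserving_snd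
  · intro t _ i
    rw [← lintegral_const_mul' _ _ ENNReal.coe_ne_top]
    refine lintegral_mono_ae ?_
    have hK' := ae_mono (Measure.restrict_mono ((hlt t).trans Ioo_subset_Icc_self) le_rfl) hK
    filter_upwards [hK'] with x hx
    exact enorm_mulVec_apply_le hx _ i
  · intro i t T ht htT x hx hxU
    have hμ : S.mu 0 ≤ S.mu i := hS.mu_strictMono.monotone (Fin.zero_le i)
    have h1 : S.mu 0 * (T - t) ≤ S.mu i * (T - t) :=
      mul_le_mul_of_nonneg_right hμ (by linarith)
    have h2 := (le_max_right _ _).trans_lt hxU.1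
    exact ⟨max_lt hx.1 (by linarith), hx.2⟩

/-! ### Vanishing of `α` -/

/-- The source of the `α` equation without its dependence on `β`. -/
noncomputable def alphaSelfSource (S : TargetSystem n m) (a : ℝ → Fin n → ℝ) (x : ℝ) : Fin n → ℝ :=
  S.Spp *ᵥ a x + ∫ ξ in (0 : ℝ)..x, S.Cp x ξ *ᵥ a ξ

lemma sourceAlpha_ae_eq {S : TargetSystem n m} {a : ℝ → Fin n → ℝ} {b : ℝ → Fin m → ℝ}
    (hb : b =ᵐ[unitMeasure] 0) : S.sourceAlpha a b =ᵐ[unitMeasure] S.alphaSelfSource a := by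
  filter_upwards [hb, ae_restrict_mem measurableSet_Icc] with x hx hx1
  have : ∫ ξ in (0 : ℝ)..x, S.Cm x ξ *ᵥ b ξ = 0 := by
    refine intervalIntegral.integral_zero_ae ?_
    filter_upwards [(ae_restrict_iff' measurableSet_Icc).1 hb] with ξ hξ hξ1
    rw [uIoc_of_le hx1.1] at hξ1
    rw [hξ ⟨hξ1.1.le, hξ1.2.trans hx1.2⟩, Pi.zero_apply, Matrix.mulVec_zero]
  simp [sourceAlpha, alphaSelfSource, hx, this]

/-- The transported profile for `α` is nonzero at `x = 0`, so a companion `ψ` is forced. Both vanish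
on `[0,1]` up to time `t₀`, and afterwards `ψ` is paired with `β = 0`, so `β` leaves no trace. -/
lemma IsL2Solution.integral_mul_alpha [NeZero n] {S : TargetSystem n m} (hS : S.Admissible)
    {α₀ : ℝ → Fin n → ℝ} {β₀ : ℝ → Fin m → ℝ} {α : ℝ → ℝ → Fin n → ℝ} {β : ℝ → ℝ → Fin m → ℝ}
    (hsol : S.IsL2Solution α₀ β₀ α β) {t₀ : ℝ} (ht₀ : 0 < t₀)
    (hβ : ∀ t, t₀ ≤ t → β t =ᵐ[unitMeasure] 0)
    {T : ℝ} (hT : 0 < T) (i : Fin n) {η : ℝ → ℝ}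
    (hη : ContDiff ℝ 1 η) (hηU : tsupport η ⊆ Ioo 0 (min 1 (S.lam 0 * (T - t₀)))) :
    ∫ x in (0 : ℝ)..1, η x * α T x i = ∫ t in (0 : ℝ)..T, ∫ x in (0 : ℝ)..1,
      η (x + S.lam i * (T - t)) * S.alphaSelfSource (α t) x i := by
  have hη0 : ∀ x, min 1 (S.lam 0 * (T - t₀)) ≤ x → η x = 0 := fun x hx =>
    image_eq_zero_of_notMem_tsupport fun hc => (hηU hc).2.not_ge hx
  have hl : S.lam 0 ≤ S.lam i := hS.lam_mono (Fin.zero_le i)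
  have hlpos : 0 < S.lam 0 := hS.lam_pos 0
  have hearly : ∀ t ≤ t₀, t ≤ T → ∀ x, 0 ≤ x → η (x + S.lam i * (T - t)) = 0 := by
    intro t ht htT x hx
    refine hη0 _ (min_le_of_right_le ?_)
    have h1 : S.lam 0 * (T - t₀) ≤ S.lam 0 * (T - t) := by gcongr
    have h2 : S.lam 0 * (T - t) ≤ S.lam i * (T - t) :=
      mul_le_mul_of_nonneg_right hl (by linarith)
    linarith
  -- Constant in `x`, with the value that the adjoint boundary condition prescribes at `x = 0`.
  set ψ : ℝ → ℝ → Fin m → ℝ := fun t _ j =>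
    (S.mu j)⁻¹ * (S.Q₀ i j * (S.lam i * η (0 + S.lam i * (T - t)))) with hψ
  have hψ0 : ∀ t ≤ t₀, ∀ x, ψ t x = 0 := by
    intro t ht x
    have : η (0 + S.lam i * (T - t)) = 0 := by
      rcases le_total t T with htT | htT
      · exact hearly t ht htT 0 le_rfl
      -- Times beyond `T` are included because `∂ₜψ = 0` needs `ψ` to vanish on a neighbourhood of
      -- `t`, even at `t = T`.
      · refine image_eq_zero_of_notMem_tsupport fun hc => (hηU hc).1.not_ge ?_
        rw [zero_add]
        exact mul_nonpos_of_nonneg_of_nonpos (hS.lam_pos i).le (by linarith)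
    ext j
    simp [hψ, -zero_add, this]
  have htest : S.IsTestPair T (fun t x => Pi.single i (η (x + S.lam i * (T - t)))) ψ := by
    refine ⟨contDiff_pi_single_comp i hη _ _, ?_, fun t ht => ?_, fun t ht => ?_⟩
    · rw [contDiff_pi]
      intro j
      exact contDiff_const.mul (contDiff_const.mul (contDiff_const.mul (hη.comp (by fun_prop))))
    · have : 0 ≤ S.lam i * (T - t) := mul_nonneg (hS.lam_pos i).le (by linarith [ht.2])
      rw [hη0 _ (min_le_of_left_le (by linarith)), Pi.single_zero]
    · ext j
      rw [Matrix.diagonal_mulVec_single, Matrix.mulVec_diagonal, Matrix.mulVec_single]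
      have := (hS.mu_pos j).ne'
      simp [hψ, this, mul_comm]
  have h := hsol.weak T hT _ _ htest
  have hTerm : ∫ x in (0 : ℝ)..1, ((Pi.single i (η (x + S.lam i * (T - T))) : Fin n → ℝ) ⬝ᵥ α T x
      + ψ T x ⬝ᵥ β T x) = ∫ x in (0 : ℝ)..1, η x * α T x i := by
    refine intervalIntegral.integral_congr_ae ?_
    rw [uIoc_of_le zero_le_one]
    have : ∀ᵐ x, x ∈ Ioc (0 : ℝ) 1 → ψ T x ⬝ᵥ β T x = 0 := by
      rcases le_total T t₀ with hTt | hTt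
      · exact Eventually.of_forall fun x _ => by simp [hψ0 T hTt]
      · filter_upwards [(ae_restrict_iff' measurableSet_Icc).1 (hβ T hTt)] with x hx hx1
        simp [hx (Ioc_subset_Icc_self hx1)]
    filter_upwards [this] with x hx hx1
    rw [hx hx1]
    simp
  have hInit : ∫ x in (0 : ℝ)..1, ((Pi.single i (η (x + S.lam i * (T - 0))) : Fin n → ℝ) ⬝ᵥ α₀ x
      + ψ 0 x ⬝ᵥ β₀ x) = 0 := by
    refine intervalIntegral.integral_zero_ae (Eventually.of_forall fun x hx => ?_)
    rw [uIoc_of_le zero_le_one] at hx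
    rw [hearly 0 ht₀.le hT.le x hx.1.le, hψ0 0 ht₀.le x]
    simp
  rw [hTerm, hInit, sub_zero] at h
  rw [h]
  refine intervalIntegral.integral_congr fun t ht => ?_
  rw [uIcc_of_le hT.le] at ht
  refine intervalIntegral.integral_congr_ae ?_
  rw [uIoc_of_le zero_le_one]
  simp only [deriv_add_diagonal_mulVec_deriv_eq_zero S.lam i hη, zero_dotProduct, zero_add,
    single_dotProduct]
  rcases lt_or_ge t t₀ with htt | htt
  · have hψ' : ∀ x, deriv (fun s => ψ s x) t = 0 := by
      intro x
      have hev : (fun s => ψ s x) =ᶠ[𝓝 t] fun _ => 0 := by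
        filter_upwards [Iio_mem_nhds htt] with s hs using hψ0 s (le_of_lt hs) x
      rw [hev.deriv_eq, deriv_const]
    refine Eventually.of_forall fun x hx => ?_
    rw [hearly t htt.le ht.2 x hx.1.le, hψ' x, hψ0 t htt.le x]
    simp [hψ]
  · have hb := hβ t htt
    filter_upwards [(ae_restrict_iff' measurableSet_Icc).1 hb,
      (ae_restrict_iff' measurableSet_Icc).1 (S.sourceAlpha_ae_eq (a := α t) hb)]
      with x hx hx' hx1
    rw [hx (Ioc_subset_Icc_self hx1), hx' (Ioc_subset_Icc_self hx1)]
    simp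

theorem IsL2Solution.alpha_ae_eq_zero [NeZero n] {S : TargetSystem n m} (hS : S.Admissible)
    {α₀ : ℝ → Fin n → ℝ} {β₀ : ℝ → Fin m → ℝ} {α : ℝ → ℝ → Fin n → ℝ} {β : ℝ → ℝ → Fin m → ℝ}
    (hsol : S.IsL2Solution α₀ β₀ α β) {t₀ : ℝ} (ht₀ : 0 < t₀)
    (hβ : ∀ t, t₀ ≤ t → β t =ᵐ[unitMeasure] 0) {T : ℝ} (hT : t₀ + 1 / S.lam 0 ≤ T) :
    α T =ᵐ[unitMeasure] 0 := by
  have hl0 : 0 < S.lam 0 := hS.lam_pos 0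
  obtain ⟨K, hK⟩ := exists_ae_forall_enorm_le hS.Cp_bdd
  obtain ⟨L, hL⟩ : ∃ L : NNReal, ∀ i j, ‖S.Spp i j‖ₑ ≤ L := by
    refine ⟨∑ i, ∑ j, ‖S.Spp i j‖₊, fun i j => ENNReal.coe_le_coe.2 ?_⟩
    refine le_trans ?_ (Finset.single_le_sum (f := fun i => ∑ j, ‖S.Spp i j‖₊)
      (fun _ _ => zero_le) (Finset.mem_univ i))
    exact Finset.single_le_sum (f := fun j => ‖S.Spp i j‖₊)
      (fun _ _ => zero_le) (Finset.mem_univ j)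
  have hK' : ∀ᵐ x : ℝ, ∀ᵐ ξ : ℝ, (x, ξ) ∈ triangle → ∀ i j, ‖S.Cp x ξ i j‖ₑ ≤ K := by
    have := (ae_restrict_iff' measurableSet_triangle).1 hK
    rw [Measure.volume_eq_prod] at this
    exact Measure.ae_ae_of_ae_prod this
  have hlt : ∀ t, Ioo 0 (min 1 (S.lam 0 * (t - t₀))) ⊆ Ioo 0 1 := fun t =>
    Ioo_subset_Ioo_right (min_le_left _ _)
  -- The region is empty for `t ≤ t₀`, so the argument can start at time `0`. In `C`, `n * L` comes
  -- from `Σ⁺⁺` and `n * K` from the Volterra term.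
  have key := ae_eq_zero_of_transport_dual hsol.curve_fst (c := S.lam)
    (h := fun t x => S.alphaSelfSource (α t) x) (U := fun t => Ioo 0 (min 1 (S.lam 0 * (t - t₀))))
    (C := n * L + n * K) ?_ (fun t => isOpen_Ioo) hlt ?_ ?_ ?_
    (fun T hT i η hη hηU => hsol.integral_mul_alpha hS ht₀ hβ hT i hη hηU)
    (T := T) (lt_of_lt_of_le (by positivity) hT)
  · refine ae_unitMeasure_of_ae_Ioo ?_
    filter_upwards [key] with x hx hx1
    refine hx ⟨hx1.1, lt_min hx1.2 ?_⟩
    have : 1 / S.lam 0 ≤ T - t₀ := by linarith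
    rw [div_le_iff₀' hl0] at this
    linarith [hx1.2]
  · exact (measurableSet_lt measurable_const measurable_snd).inter
      (measurableSet_lt (g := fun p : ℝ × ℝ => min 1 (S.lam 0 * (p.1 - t₀))) measurable_snd
        (by fun_prop))
  · intro i
    refine AEStronglyMeasurable.add (aestronglyMeasurable_mulVec_apply
      (A := fun _ : ℝ × ℝ => S.Spp) (fun j => aestronglyMeasurable_const)
      hsol.curve_fst.aestronglyMeasurable) ?_
    exact (continuous_apply i).comp_aestronglyMeasurable
      (aestronglyMeasurable_volterra (fun i j => (hS.Cp_bdd i j).1)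
        hsol.curve_fst.aestronglyMeasurable)
  · intro t _ i
    set r := min 1 (S.lam 0 * (t - t₀)) with hr
    set N := ∫⁻ x in Ioo 0 r, ‖α t x‖ₑ with hN
    have hpt : ∀ᵐ x, x ∈ Ioo 0 r → ‖S.alphaSelfSource (α t) x i‖ₑ
        ≤ (n * L : NNReal) * ‖α t x‖ₑ + (n * K : NNReal) * N := by
      filter_upwards [hK'] with x hx hxr
      refine (enorm_add_le _ _).trans (add_le_add (enorm_mulVec_apply_le hL _ i) ?_)
      have hx1 : x ≤ 1 := (hxr.2.trans_le (min_le_left _ _)).le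
      calc ‖(∫ ξ in (0 : ℝ)..x, S.Cp x ξ *ᵥ α t ξ) i‖ₑ
          ≤ ‖∫ ξ in (0 : ℝ)..x, S.Cp x ξ *ᵥ α t ξ‖ₑ :=
            ENNReal.coe_le_coe.2 (nnnorm_le_pi_nnnorm _ i)
        _ ≤ ∫⁻ ξ in Ioc 0 x, ‖S.Cp x ξ *ᵥ α t ξ‖ₑ := by
            rw [intervalIntegral.integral_of_le hxr.1.le]
            exact enorm_integral_le_lintegral_enorm _
        _ ≤ ∫⁻ ξ in Ioc 0 x, (n * K : NNReal) * ‖α t ξ‖ₑ := by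
            refine lintegral_mono_ae ((ae_restrict_iff' measurableSet_Ioc).2 ?_)
            filter_upwards [hx] with ξ hξ hξx
            exact enorm_mulVec_le (hξ ⟨hξx.1.le, hξx.2, hx1⟩) _
        _ = (n * K : NNReal) * ∫⁻ ξ in Ioc 0 x, ‖α t ξ‖ₑ :=
            lintegral_const_mul' _ _ ENNReal.coe_ne_top
        _ ≤ (n * K : NNReal) * N := by
            gcongr
            -- For `x` in the region, the Volterra operator only sees `(0, x]`, which lies in the
            -- region too.
            exact lintegral_mono_set fun ξ hξ => ⟨hξ.1, hξ.2.trans_lt hxr.2⟩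
    calc ∫⁻ x in Ioo 0 r, ‖S.alphaSelfSource (α t) x i‖ₑ
        ≤ ∫⁻ x in Ioo 0 r, ((n * L : NNReal) * ‖α t x‖ₑ + (n * K : NNReal) * N) :=
          lintegral_mono_ae ((ae_restrict_iff' measurableSet_Ioo).2 hpt)
      _ = (n * L : NNReal) * N + (n * K : NNReal) * N * volume (Ioo 0 r) := by
          rw [lintegral_add_right _ measurable_const, lintegral_const_mul' _ _ ENNReal.coe_ne_top,
            setLIntegral_const]
      _ ≤ (n * L : NNReal) * N + (n * K : NNReal) * N * 1 := by
          gcongr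
          rw [Real.volume_Ioo, sub_zero]
          exact ENNReal.ofReal_le_one.2 (min_le_left _ _)
      _ = _ := by push_cast; ring
  · intro i t T ht htT x hx hxU
    have hl : S.lam 0 ≤ S.lam i := hS.lam_mono (Fin.zero_le i)
    have h1 : S.lam 0 * (T - t) ≤ S.lam i * (T - t) :=
      mul_le_mul_of_nonneg_right hl (by linarith)
    have h2 := hxU.2.trans_le (min_le_right _ _)
    exact ⟨hx.1, lt_min hx.2 (by linarith)⟩

end TargetSystem

theorem lemma2 {n m : ℕ} [NeZero n] [NeZero m] (S : TargetSystem n m) (hS : S.Admissible)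
    (α₀ : ℝ → Fin n → ℝ) (β₀ : ℝ → Fin m → ℝ)
    (hα₀ : MemLp α₀ 2 unitMeasure) (hβ₀ : MemLp β₀ 2 unitMeasure)
    (α : ℝ → ℝ → Fin n → ℝ) (β : ℝ → ℝ → Fin m → ℝ)
    (hsol : S.IsL2Solution α₀ β₀ α β) :
    (∀ t, 1 / S.mu 0 ≤ t → β t =ᵐ[unitMeasure] 0) ∧
    (∀ t, 1 / S.mu 0 + 1 / S.lam 0 ≤ t →
      α t =ᵐ[unitMeasure] 0 ∧ β t =ᵐ[unitMeasure] 0) := by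
  have hβ : ∀ t, 1 / S.mu 0 ≤ t → β t =ᵐ[unitMeasure] 0 := fun t ht =>
    hsol.beta_ae_eq_zero hS ht
  have hl : 0 < 1 / S.lam 0 := one_div_pos.2 (hS.lam_pos 0)
  exact ⟨hβ, fun t ht =>
    ⟨hsol.alpha_ae_eq_zero hS (one_div_pos.2 (hS.mu_pos 0)) hβ ht, hβ t (by linarith)⟩⟩
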